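/- There are absolute constants $C, K, c > 0$ such that the following holds for all integers $n \ge 2$, $m \ge n$ and $k \ge 2$. Take any (possibly randomized and adaptive) sequential algorithm that places $m$ balls one by one into $n$ initially empty bins as follows: for each ball it makes at least one and at most $k$ probes, each probe being a uniformly random one of the $n$ bins, independent of every other probe and of everything that happened before it; after each probe the algorithm decides, on the basis of everything that has happened so far and possibly of internal randomness, whether to probe again or to stop, and when it stops it places the ball into one of the bins probed for that ball. Then, with probability at least $1 - K n^{-c}$, the maximum load of any bin after all $m$ balls have been placed is at least $$\frac{m}{n} + \frac{\ln\ln n}{\ln k} - C .$$ -/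

import Mathlib

/-- A ball that has been placed: the bins it probed, in the order of the probes (repetitions
are possible), and the bin it was put into. -/
abbrev BallRecord (n : ℕ) : Type := List (Fin n) × Fin n

/-- What has happened so far: the records of all the balls placed, the latest one first. -/
abbrev History (n : ℕ) : Type := List (BallRecord n)

/-- The load of bin `b`: the number of balls placed in it. -/
def load {n : ℕ} (H : History n) (b : Fin n) : ℕ :=
  H.countP (fun r => r.2 = b)

/-- The maximum load of any bin. -/
def maxLoad {n : ℕ} (H : History n) : ℕ :=
  Finset.univ.sup (load H)

/-- A sequential, adaptive, possibly randomized allocation algorithm for `n` bins that uses at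
most `k` probes for each ball. It does not choose where it probes; it chooses, on the basis of
everything that has happened (`H`: the complete history of the earlier balls, hence in particular
all loads; `ps`: the probes already made for the current ball), whether to stop probing, and then
which of the probed bins receives the ball.

Both decisions are given by their conditional laws given everything that has happened, so that
no restriction is put on the internal randomness of the algorithm. The first probe of a ball is
always made, so only the values at nonempty `ps` matter. -/
structure ProbeAlgorithm (n k : ℕ) where
  /-- The law of the decision to stop probing (`true`) or to make one more probe (`false`). -/
  halt : History n → List (Fin n) → PMF Bool
  /-- The law of the bin into which the ball is placed, once probing has stopped. -/
  choose : History n → List (Fin n) → PMF (Fin n)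
  /-- At most `k` probes are used: after `k` of them the algorithm stops. -/
  halt_of_le : ∀ (H : History n) (ps : List (Fin n)), k ≤ ps.length → halt H ps = PMF.pure true
  /-- The ball is placed into a bin that it has probed. -/
  choose_mem : ∀ (H : History n) (ps : List (Fin n)), ps ≠ [] →
    ∀ b ∈ (choose H ps).support, b ∈ ps

namespace ProbeAlgorithm

variable {n k : ℕ} [NeZero n]

/-- The law of the record of the current ball, when the probes `ps` have been made for it and at
most `r` further probes can follow. Every further probe is a fresh uniformly random bin,
independent of all that precedes. -/
noncomputable def serve (A : ProbeAlgorithm n k) (H : History n) :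
    ℕ → List (Fin n) → PMF (BallRecord n)
  | 0, ps => (A.choose H ps).map (fun b => (ps, b))
  | r + 1, ps =>
      (A.halt H ps).bind fun s =>
        if s = true then (A.choose H ps).map (fun b => (ps, b))
        else (PMF.uniformOfFintype (Fin n)).bind fun x => A.serve H r (ps ++ [x])

/-- The law of the record of the next ball: a first uniformly random probe, and then at most
`k - 1` further ones. -/
noncomputable def placeBall (A : ProbeAlgorithm n k) (H : History n) : PMF (BallRecord n) :=
  (PMF.uniformOfFintype (Fin n)).bind fun x => A.serve H (k - 1) [x]

/-- The law of the history after `m` balls have been placed one by one into `n` empty bins. -/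
noncomputable def run (A : ProbeAlgorithm n k) : ℕ → PMF (History n)
  | 0 => PMF.pure []
  | m + 1 => (A.run m).bind fun H => (A.placeBall H).map (fun r => r :: H)

/-- The law of the maximum load after `m` balls have been placed. -/
noncomputable def maxLoadLaw (A : ProbeAlgorithm n k) (m : ℕ) : PMF ℕ :=
  (A.run m).map maxLoad

end ProbeAlgorithm

/-!
The proof is a layered induction over the last `n` balls. Write `a = ⌊(m - n) / n⌋`, so that all
the loads add up to at least `n * a` once `m - n` balls have been placed. By pigeonhole
(`exists_le_tall`) there is then, whatever the algorithm did, some `i` such that at least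
`n / 2 ^ (i + 1)` bins have load at least `a + i`.

Suppose that at least `x` bins have load at least `h`. As long as fewer than `x / 2` bins have load
at least `h + 1`, at least `x / 2` bins have load exactly `h`, and with probability at least
`p = (x / 2n) ^ k` all probes of the next ball hit such bins, so that one of them is raised to
`h + 1` (`ProbeAlgorithm.pow_le_expect_placeBall`). An exponential moment estimate
(`ProbeAlgorithm.iterate_next_tall_le`) shows that, if `w * p / 4 ≤ x / 2`, then after `w` balls at
least `w * p / 4` bins have load at least `h + 1`, except with probability `exp (-w * p / 4)`. With `x = n / 2 ^ e j` and
`w = n / 2 ^ (j + 1)` balls for layer `j`, one gets `n / 2 ^ e (j + 1)` bins in the next layer,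
where `e (j + 1) = k * e j + k + j + 4` (`layerExp`), so that `e j ≤ 8 * k ^ j`. Since
`e j ≥ j + 1`, the induction can join in at whichever layer the pigeonhole argument supplies.

For `J` about `log (log n) / log k` the last exponent satisfies `2 ^ e J ≤ √n`; hence each layer
fails with probability at most `exp (-√n)`, and all of them together with probability at most
`n * exp (-√n) ≤ 24 / n`.
-/

open scoped ENNReal

/-! ### Expectations under a probability mass function -/

namespace PMF

variable {α β : Type*}

/-- The expectation of an extended nonnegative function under a probability mass function. -/
noncomputable def expect (p : PMF α) (f : α → ℝ≥0∞) : ℝ≥0∞ := ∑' a, p a * f a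

theorem expect_mono (p : PMF α) {f g : α → ℝ≥0∞} (h : ∀ a ∈ p.support, f a ≤ g a) :
    p.expect f ≤ p.expect g := by
  refine ENNReal.tsum_le_tsum fun a => ?_
  by_cases ha : p a = 0
  · simp [ha]
  · gcongr
    exact h a ((p.mem_support_iff a).2 ha)

theorem expect_const (p : PMF α) (c : ℝ≥0∞) : p.expect (fun _ => c) = c := by
  simp [expect, ENNReal.tsum_mul_right, p.tsum_coe]

theorem expect_add (p : PMF α) (f g : α → ℝ≥0∞) :
    p.expect (fun a => f a + g a) = p.expect f + p.expect g := by
  simp [expect, mul_add, ENNReal.tsum_add]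

theorem expect_const_mul (p : PMF α) (c : ℝ≥0∞) (f : α → ℝ≥0∞) :
    p.expect (fun a => c * f a) = c * p.expect f := by
  simp only [expect, ← ENNReal.tsum_mul_left]
  exact tsum_congr fun a => by ring

theorem expect_pure (a : α) (f : α → ℝ≥0∞) : (PMF.pure a).expect f = f a := by
  rw [expect, tsum_eq_single a]
  · simp
  · intro b hb
    simp [PMF.pure_apply, hb]

theorem expect_bind (p : PMF α) (q : α → PMF β) (f : β → ℝ≥0∞) :
    (p.bind q).expect f = p.expect fun a => (q a).expect f := by
  simp only [expect, PMF.bind_apply, ← ENNReal.tsum_mul_right, ← ENNReal.tsum_mul_left]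
  rw [ENNReal.tsum_comm]
  exact tsum_congr fun a => tsum_congr fun b => by ring

theorem expect_map (p : PMF α) (g : α → β) (f : β → ℝ≥0∞) :
    (p.map g).expect f = p.expect (f ∘ g) := by
  rw [← PMF.bind_pure_comp, expect_bind]
  simp only [Function.comp_apply, expect_pure]
  rfl

open Classical in
theorem expect_indicator (p : PMF α) (S : Set α) :
    p.expect (fun a => if a ∈ S then 1 else 0) = p.toOuterMeasure S := by
  rw [toOuterMeasure_apply, expect]
  refine tsum_congr fun a => ?_
  by_cases h : a ∈ S <;> simp [h]

theorem expect_uniformOfFintype_indicator {n : ℕ} [NeZero n] (S : Finset (Fin n)) :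
    (PMF.uniformOfFintype (Fin n)).expect (fun x => if x ∈ S then 1 else 0)
      = (S.card : ℝ≥0∞) / n := by
  rw [expect, tsum_fintype]
  simp [Finset.sum_ite_mem, div_eq_mul_inv]

end PMF

/-! ### One ball, and the transition operator of the process -/

namespace ProbeAlgorithm

variable {n k : ℕ} [NeZero n]

theorem pow_le_expect_serve (A : ProbeAlgorithm n k) (H : History n) (S : Finset (Fin n))
    (r : ℕ) (ps : List (Fin n)) (hne : ps ≠ []) (hps : ∀ x ∈ ps, x ∈ S) :
    ((S.card : ℝ≥0∞) / n) ^ r ≤ (A.serve H r ps).expect (fun c => if c.2 ∈ S then 1 else 0) := by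
  have hdone : ∀ ps : List (Fin n), ps ≠ [] → (∀ x ∈ ps, x ∈ S) →
      1 ≤ ((A.choose H ps).map (fun b => (ps, b))).expect
        (fun c => if c.2 ∈ S then (1 : ℝ≥0∞) else 0) := by
    intro ps hne hps
    rw [PMF.expect_map]
    calc (1 : ℝ≥0∞) = (A.choose H ps).expect (fun _ => 1) := (PMF.expect_const _ _).symm
      _ ≤ _ := PMF.expect_mono _ fun b hb => by
        simp [hps b (A.choose_mem H ps hne b hb)]
  have hq : (S.card : ℝ≥0∞) / n ≤ 1 := by
    refine ENNReal.div_le_of_le_mul ?_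
    rw [one_mul]
    exact_mod_cast (Finset.card_le_univ S).trans_eq (Fintype.card_fin n)
  induction r generalizing ps with
  | zero => simpa [serve] using hdone ps hne hps
  | succ r ih =>
    rw [serve, PMF.expect_bind]
    calc ((S.card : ℝ≥0∞) / n) ^ (r + 1)
        = (A.halt H ps).expect (fun _ => ((S.card : ℝ≥0∞) / n) ^ (r + 1)) :=
          (PMF.expect_const _ _).symm
      _ ≤ _ := PMF.expect_mono _ fun s _ => ?_
    split_ifs
    · exact (pow_le_one₀ (zero_le) hq).trans (hdone ps hne hps)
    · rw [PMF.expect_bind, pow_succ, ← PMF.expect_uniformOfFintype_indicator S,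
        ← PMF.expect_const_mul]
      refine PMF.expect_mono _ fun x _ => ?_
      by_cases hx : x ∈ S
      · rw [if_pos hx, mul_one, PMF.expect_uniformOfFintype_indicator]
        refine ih (ps ++ [x]) (by simp) fun y hy => ?_
        rcases List.mem_append.1 hy with hy | hy
        · exact hps y hy
        · rwa [List.mem_singleton.1 hy]
      · simp [hx]

/-- If all probes of a ball fall into `S`, then `S` receives the ball whatever the algorithm
decides; as there are at most `k` probes, this has probability at least `(|S| / n) ^ k`. -/
theorem pow_le_expect_placeBall (A : ProbeAlgorithm n k) (hk : 1 ≤ k) (H : History n)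
    (S : Finset (Fin n)) :
    ((S.card : ℝ≥0∞) / n) ^ k ≤ (A.placeBall H).expect (fun c => if c.2 ∈ S then 1 else 0) := by
  obtain ⟨k', rfl⟩ : ∃ k', k = k' + 1 := ⟨k - 1, by omega⟩
  rw [placeBall, PMF.expect_bind, pow_succ, ← PMF.expect_uniformOfFintype_indicator S,
    ← PMF.expect_const_mul]
  refine PMF.expect_mono _ fun x _ => ?_
  by_cases hx : x ∈ S
  · rw [if_pos hx, mul_one, PMF.expect_uniformOfFintype_indicator]
    exact A.pow_le_expect_serve H S k' [x] (by simp) (by simpa using hx)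
  · simp [hx]

/-- The transition operator of the process: the expected value of `f` after one more ball, as a
function of the current history. -/
noncomputable def next (A : ProbeAlgorithm n k) (f : History n → ℝ≥0∞) (H : History n) : ℝ≥0∞ :=
  (A.placeBall H).expect fun r => f (r :: H)

theorem expect_run_add (A : ProbeAlgorithm n k) (t w : ℕ) (f : History n → ℝ≥0∞) :
    (A.run (t + w)).expect f = (A.run t).expect (A.next^[w] f) := by
  induction w generalizing f with
  | zero => rfl
  | succ w ih =>
    rw [Function.iterate_succ_apply, ← ih, ← add_assoc, run, PMF.expect_bind]
    simp only [PMF.expect_map]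
    rfl

theorem length_of_mem_support_run (A : ProbeAlgorithm n k) (t : ℕ) :
    ∀ H ∈ (A.run t).support, H.length = t := by
  induction t with
  | zero => simp [run]
  | succ t ih =>
    intro H hH
    simp only [run, PMF.mem_support_bind_iff, PMF.mem_support_map_iff] at hH
    obtain ⟨H', hH', r, -, rfl⟩ := hH
    simp [ih H' hH']

theorem iterate_next_mono (A : ProbeAlgorithm n k) {f g : History n → ℝ≥0∞} (h : ∀ H, f H ≤ g H)
    (w : ℕ) (H : History n) : A.next^[w] f H ≤ A.next^[w] g H := by
  induction w generalizing H with
  | zero => exact h H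
  | succ w ih =>
    rw [Function.iterate_succ_apply', Function.iterate_succ_apply']
    exact PMF.expect_mono _ fun r _ => ih _

theorem iterate_next_eq_zero (A : ProbeAlgorithm n k) {f : History n → ℝ≥0∞}
    {P : History n → Prop} (hP : ∀ r H, P H → P (r :: H)) (hf : ∀ H, P H → f H = 0)
    (w : ℕ) {H : History n} (hH : P H) : A.next^[w] f H = 0 := by
  induction w generalizing H with
  | zero => exact hf H hH
  | succ w ih =>
    rw [Function.iterate_succ_apply', next]
    simp only [ih (hP _ H hH)]
    exact PMF.expect_const _ 0

end ProbeAlgorithm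

/-! ### Counting bins by their load -/

/-- The number of bins with load at least `h`. -/
def tall {n : ℕ} (h : ℕ) (H : History n) : ℕ := (Finset.univ.filter fun b => h ≤ load H b).card

section Load

variable {n : ℕ}

theorem load_cons (r : BallRecord n) (H : History n) (b : Fin n) :
    load (r :: H) b = load H b + if r.2 = b then 1 else 0 := by
  simp [load, List.countP_cons]

theorem sum_load (H : History n) : ∑ b, load H b = H.length := by
  induction H with
  | nil => simp [load]
  | cons r H ih => simp [load_cons, Finset.sum_add_distrib, ih]

theorem tall_le_tall_cons (h : ℕ) (r : BallRecord n) (H : History n) :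
    tall h H ≤ tall h (r :: H) := by
  refine Finset.card_le_card fun b => ?_
  simp only [Finset.mem_filter, Finset.mem_univ, true_and, load_cons]
  omega

theorem tall_add_one_le_tall_cons {h : ℕ} {r : BallRecord n} {H : History n}
    (hr : load H r.2 = h) : tall (h + 1) H + 1 ≤ tall (h + 1) (r :: H) := by
  have hnot : r.2 ∉ Finset.univ.filter fun b => h + 1 ≤ load H b := by simp [hr]
  rw [tall, ← Finset.card_insert_of_notMem hnot]
  refine Finset.card_le_card fun b hb => ?_
  simp only [Finset.mem_insert, Finset.mem_filter, Finset.mem_univ, true_and, load_cons] at hb ⊢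
  rcases hb with rfl | hb
  · simp [hr]
  · omega

theorem tall_eq_card_add (h : ℕ) (H : History n) :
    tall h H = (Finset.univ.filter fun b => load H b = h).card + tall (h + 1) H := by
  rw [tall, tall, ← Finset.card_union_of_disjoint]
  · congr 1
    ext b
    simp only [Finset.mem_union, Finset.mem_filter, Finset.mem_univ, true_and]
    omega
  · rw [Finset.disjoint_filter]
    intros
    omega

/-- Layer-cake count of the load in excess of `a - 1`; the truncated subtraction makes it the
positive part, and also covers `a = 0`. -/
theorem sum_load_excess (a M : ℕ) (H : History n) (hM : H.length < M) :
    ∑ b, (load H b + 1 - a) ≤ ∑ i ∈ Finset.range M, tall (a + i) H := by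
  simp only [tall, Finset.card_filter]
  rw [Finset.sum_comm]
  refine Finset.sum_le_sum fun b _ => ?_
  rw [← Finset.card_filter]
  have hb : load H b ≤ H.length := List.countP_le_length
  calc load H b + 1 - a = (Finset.range (load H b + 1 - a)).card := by simp
    _ ≤ _ := Finset.card_le_card fun i hi => by
      simp only [Finset.mem_range, Finset.mem_filter] at hi ⊢
      omega

/-- If the average load is at least `a`, then the loads exceed `a - 1` by at least `n` in total, so
the upper tail cannot lie below the geometric sequence `n / 2 ^ (i + 1)` at every level. -/
theorem exists_le_tall [NeZero n] {a : ℕ} {H : History n} (ha : n * a ≤ H.length) :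
    ∃ i, (n : ℝ) / 2 ^ (i + 1) ≤ tall (a + i) H := by
  by_contra! hcon
  have hn : (0 : ℝ) < n := by exact_mod_cast NeZero.pos n
  have hgeom : ∀ M : ℕ, ∑ i ∈ Finset.range M, (n : ℝ) / 2 ^ (i + 1) = n - n / 2 ^ M := by
    intro M
    induction M with
    | zero => simp
    | succ M ih => rw [Finset.sum_range_succ, ih, pow_succ]; field_simp; ring
  have h1 := sum_load_excess a (H.length + 1) H (Nat.lt_succ_self _)
  have h2 : n ≤ ∑ b, (load H b + 1 - a) := by
    have h3 : ∑ b : Fin n, (load H b + 1) ≤ ∑ b : Fin n, ((load H b + 1 - a) + a) :=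
      Finset.sum_le_sum fun b _ => by omega
    simp only [Finset.sum_add_distrib, sum_load, Finset.sum_const, Finset.card_univ,
      Fintype.card_fin, smul_eq_mul] at h3
    omega
  have h4 : ((∑ i ∈ Finset.range (H.length + 1), tall (a + i) H : ℕ) : ℝ) ≤
      n - n / 2 ^ (H.length + 1) := by
    push_cast
    rw [← hgeom]
    exact Finset.sum_le_sum fun i _ => (hcon i).le
  have h5 : (n : ℝ) ≤ ((∑ i ∈ Finset.range (H.length + 1), tall (a + i) H : ℕ) : ℝ) := by
    exact_mod_cast h2.trans h1
  have h6 : 0 < (n : ℝ) / 2 ^ (H.length + 1) := by positivity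
  linarith

theorem le_maxLoad_of_tall_pos {h : ℕ} {H : History n} (hpos : 0 < tall h H) :
    h ≤ maxLoad H := by
  obtain ⟨b, hb⟩ := Finset.card_pos.1 hpos
  exact (Finset.mem_filter.1 hb).2.trans (Finset.le_sup (f := load H) (Finset.mem_univ b))

end Load

/-! ### Growth of a single layer -/

namespace ProbeAlgorithm

variable {n k : ℕ} [NeZero n]

open Classical in
/-- While fewer than `s ≤ x / 2` bins have load above `h`, at least `x / 2` bins have load exactly
`h`, so that each ball raises one of them with probability at least `p = (x / 2n) ^ k`. The
exponential moment of the number of bins above `h` therefore shrinks by `exp (-p / 2)` per ball. -/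
theorem iterate_next_tall_le (A : ProbeAlgorithm n k) (hk : 1 ≤ k) (h : ℕ) {x s : ℝ}
    (hx : 0 ≤ x) (hs : s ≤ x / 2) (w : ℕ) (H : History n) (hH : x ≤ tall h H) :
    A.next^[w] (fun H => if (tall (h + 1) H : ℝ) < s then 1 else 0) H ≤
      ENNReal.ofReal (Real.exp (s - tall (h + 1) H - w * ((x / (2 * n)) ^ k / 2))) := by
  have hn : (0 : ℝ) < n := by exact_mod_cast NeZero.pos n
  induction w generalizing H with
  | zero =>
    simp only [Function.iterate_zero, id_eq]
    split_ifs with hlt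
    · rw [ENNReal.one_le_ofReal]
      exact Real.one_le_exp (by push_cast; linarith)
    · exact zero_le
  | succ w ih =>
    by_cases hlt : (tall (h + 1) H : ℝ) < s
    swap
    · rw [A.iterate_next_eq_zero (P := fun H => s ≤ tall (h + 1) H) _ _ _ (not_lt.1 hlt)]
      · exact zero_le
      · intro r H hH
        exact hH.trans (by exact_mod_cast tall_le_tall_cons _ _ _)
      · intro H hH
        rw [if_neg (not_lt.2 hH)]
    rw [Function.iterate_succ_apply', next]
    set p : ℝ := (x / (2 * n)) ^ k with hp
    set S : Finset (Fin n) := Finset.univ.filter fun b => load H b = h with hS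
    set y : ℝ := Real.exp (s - tall (h + 1) H - w * (p / 2)) with hy
    have hy0 : 0 < y := Real.exp_pos _
    have hScard : x / 2 ≤ S.card := by
      have : (tall h H : ℝ) = S.card + tall (h + 1) H := by exact_mod_cast tall_eq_card_add h H
      linarith
    have hpE : ENNReal.ofReal p ≤
        (A.placeBall H).expect (fun c => if c.2 ∈ S then 1 else 0) := by
      refine le_trans ?_ (A.pow_le_expect_placeBall hk H S)
      rw [hp, ENNReal.ofReal_pow (by positivity)]
      gcongr
      rw [← ENNReal.ofReal_natCast S.card, ← ENNReal.ofReal_natCast n,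
        ← ENNReal.ofReal_div_of_pos hn]
      apply ENNReal.ofReal_le_ofReal
      rw [← div_div]
      gcongr
    have hp0 : 0 ≤ p := by positivity
    -- The bound `y` is not exceeded after the ball, and it drops to `y / 2` if the ball raises a
    -- bin to load `h + 1`, since `exp (-1) ≤ 1 / 2`.
    have hstep : ∀ r : BallRecord n,
        A.next^[w] (fun H => if (tall (h + 1) H : ℝ) < s then 1 else 0) (r :: H) +
          ENNReal.ofReal (y / 2) * (if r.2 ∈ S then 1 else 0) ≤ ENNReal.ofReal y := by
      intro r
      have hle := ih (r :: H) (hH.trans (by exact_mod_cast tall_le_tall_cons _ _ _))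
      by_cases hr : r.2 ∈ S
      · rw [if_pos hr, mul_one]
        have hrH : load H r.2 = h := (Finset.mem_filter.1 hr).2
        have hup : (tall (h + 1) H : ℝ) + 1 ≤ tall (h + 1) (r :: H) := by
          exact_mod_cast tall_add_one_le_tall_cons hrH
        have hhalf : Real.exp (s - tall (h + 1) (r :: H) - w * (p / 2)) ≤ y / 2 := by
          have h2 : (2 : ℝ) ≤ Real.exp 1 := by linarith [Real.add_one_le_exp (1 : ℝ)]
          rw [le_div_iff₀ two_pos]
          calc Real.exp (s - tall (h + 1) (r :: H) - w * (p / 2)) * 2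
              ≤ Real.exp (s - tall (h + 1) (r :: H) - w * (p / 2)) * Real.exp 1 := by gcongr
            _ ≤ y := by
              rw [← Real.exp_add, hy]
              exact Real.exp_le_exp.2 (by linarith)
        calc _ ≤ ENNReal.ofReal (y / 2) + ENNReal.ofReal (y / 2) := by
              gcongr
              exact hle.trans (ENNReal.ofReal_le_ofReal hhalf)
          _ = _ := by
              rw [← ENNReal.ofReal_add (by positivity) (by positivity), add_halves]
      · rw [if_neg hr, mul_zero, add_zero]
        refine hle.trans (ENNReal.ofReal_le_ofReal (Real.exp_le_exp.2 ?_))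
        have : (tall (h + 1) H : ℝ) ≤ tall (h + 1) (r :: H) := by
          exact_mod_cast tall_le_tall_cons _ _ _
        linarith
    have htot := PMF.expect_mono (A.placeBall H) fun r _ => hstep r
    rw [PMF.expect_add, PMF.expect_const_mul, PMF.expect_const] at htot
    have htot' : (A.placeBall H).expect (fun r =>
        A.next^[w] (fun H => if (tall (h + 1) H : ℝ) < s then 1 else 0) (r :: H)) +
          ENNReal.ofReal (y / 2 * p) ≤ ENNReal.ofReal y := by
      rw [ENNReal.ofReal_mul (by positivity)]
      exact le_trans (by gcongr) htot
    refine (ENNReal.le_sub_of_add_le_right ENNReal.ofReal_ne_top htot').trans ?_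
    rw [← ENNReal.ofReal_sub _ (by positivity)]
    apply ENNReal.ofReal_le_ofReal
    calc y - y / 2 * p = y * (-(p / 2) + 1) := by ring
      _ ≤ y * Real.exp (-(p / 2)) := by gcongr; exact Real.add_one_le_exp _
      _ = _ := by
        rw [hy, ← Real.exp_add]
        congr 1
        push_cast
        ring

end ProbeAlgorithm

/-! ### The layered induction -/

/-- The exponents of the layered induction: of the `n` bins, at least `n / 2 ^ layerExp k j` will
be shown to reach layer `j`. -/
def layerExp (k : ℕ) : ℕ → ℕ
  | 0 => 1
  | j + 1 => k * layerExp k j + k + j + 4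

theorem layerExp_lt_succ {k : ℕ} (hk : 1 ≤ k) (j : ℕ) : layerExp k j < layerExp k (j + 1) := by
  rw [layerExp]
  nlinarith

theorem layerExp_strictMono {k : ℕ} (hk : 1 ≤ k) : StrictMono (layerExp k) :=
  strictMono_nat_of_lt_succ (layerExp_lt_succ hk)

theorem succ_le_layerExp {k : ℕ} (hk : 1 ≤ k) (j : ℕ) : j + 1 ≤ layerExp k j := by
  induction j with
  | zero => simp [layerExp]
  | succ j ih => have := layerExp_lt_succ hk j; omega

theorem layerExp_le {k : ℕ} (hk : 2 ≤ k) (j : ℕ) : layerExp k j + j + 7 ≤ 8 * k ^ j := by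
  induction j with
  | zero => simp [layerExp]
  | succ j ih =>
    rw [layerExp, pow_succ]
    have := Nat.mul_le_mul_right k ih
    nlinarith [Nat.mul_le_mul_right j hk]

/-- For some `i ≥ j`, sufficiently many bins have load at least `a + i`. The layer `i` is left
free, because a history can start out with a long thin upper tail, and because the property then
persists when balls are added. -/
def LayerReached {n : ℕ} (k a j : ℕ) (H : History n) : Prop :=
  ∃ i, j ≤ i ∧ (n : ℝ) / 2 ^ layerExp k i ≤ tall (a + i) H

theorem LayerReached.cons {n k a j : ℕ} (r : BallRecord n) (H : History n)
    (h : LayerReached k a j H) : LayerReached k a j (r :: H) := by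
  obtain ⟨i, hi, hle⟩ := h
  exact ⟨i, hi, hle.trans (by exact_mod_cast tall_le_tall_cons _ _ _)⟩

theorem layerReached_zero {n k a : ℕ} [NeZero n] (hk : 1 ≤ k) {H : History n}
    (ha : n * a ≤ H.length) : LayerReached k a 0 H := by
  obtain ⟨i, hi⟩ := exists_le_tall ha
  refine ⟨i, i.zero_le, le_trans ?_ hi⟩
  gcongr
  · exact one_le_two
  · exact succ_le_layerExp hk i

theorem LayerReached.le_maxLoad {n k a j : ℕ} [NeZero n] {H : History n}
    (h : LayerReached k a j H) : a + j ≤ maxLoad H := by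
  obtain ⟨i, hi, hle⟩ := h
  have hn : (0 : ℝ) < n := by exact_mod_cast NeZero.pos n
  have hpos : (0 : ℝ) < tall (a + i) H := lt_of_lt_of_le (by positivity) hle
  have := le_maxLoad_of_tall_pos (H := H) (h := a + i) (by exact_mod_cast hpos)
  omega

namespace ProbeAlgorithm

variable {n k : ℕ} [NeZero n]

open Classical in
theorem iterate_next_not_layerReached_le (A : ProbeAlgorithm n k) (hk : 1 ≤ k) (a j : ℕ)
    (hj : 2 ^ (j + 1) ≤ n) {H : History n} (hH : LayerReached k a j H) :
    A.next^[n / 2 ^ (j + 1)] (fun H => if LayerReached k a (j + 1) H then 0 else 1) H ≤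
      ENNReal.ofReal (Real.exp (-(n / 2 ^ layerExp k (j + 1)))) := by
  have hn : (0 : ℝ) < n := by exact_mod_cast NeZero.pos n
  obtain ⟨i, hi, hle⟩ := hH
  rcases hi.lt_or_eq with hlt | rfl
  · rw [A.iterate_next_eq_zero (P := LayerReached k a (j + 1)) LayerReached.cons
      (fun H hH => if_pos hH) _ ⟨i, hlt, hle⟩]
    exact zero_le
  set e := layerExp k j with he
  set w := n / 2 ^ (j + 1) with hw
  set s : ℝ := n / 2 ^ layerExp k (j + 1) with hs
  set x : ℝ := n / 2 ^ e with hx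
  have hsx : s ≤ x / 2 := by
    rw [hs, hx, div_div, ← pow_succ]
    gcongr
    · exact one_le_two
    · exact layerExp_lt_succ hk j
  -- Truncating the division costs a factor of at most two.
  have hwn : (n : ℝ) / 2 ^ (j + 2) ≤ w := by
    have h1 : 1 ≤ w := (Nat.one_le_div_iff (by positivity)).2 hj
    have h2 : n < (w + 1) * 2 ^ (j + 1) := by
      rw [mul_comm]
      exact Nat.lt_mul_div_succ n (by positivity)
    have h3 : n ≤ w * 2 ^ (j + 2) := by
      rw [pow_succ _ (j + 1)]
      nlinarith [Nat.mul_le_mul_right (2 ^ (j + 1)) h1]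
    rw [div_le_iff₀ (by positivity)]
    exact_mod_cast h3
  have hp : (x / (2 * n)) ^ k = 1 / 2 ^ (k * e + k) := by
    have : x / (2 * n) = 1 / 2 ^ (e + 1) := by
      rw [hx, pow_succ]
      field_simp
    rw [this, div_pow, one_pow, ← pow_mul]
    congr 2
    ring
  have hmain : 2 * s ≤ w * ((x / (2 * n)) ^ k / 2) := by
    calc 2 * s = (n : ℝ) / 2 ^ (j + 2) * (1 / 2 ^ (k * e + k) / 2) := by
          rw [hs, layerExp, ← he, show k * e + k + j + 4 = (k * e + k) + (j + 2) + 2 by ring,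
            pow_add, pow_add _ (k * e + k)]
          field_simp
      _ ≤ _ := by
          rw [hp]
          gcongr
  have hf : ∀ H : History n, (if LayerReached k a (j + 1) H then (0 : ℝ≥0∞) else 1) ≤
      if (tall (a + j + 1) H : ℝ) < s then 1 else 0 := by
    intro H
    by_cases h : LayerReached k a (j + 1) H
    · simp [h]
    · have : (tall (a + j + 1) H : ℝ) < s := by
        by_contra! hcon
        exact h ⟨j + 1, le_rfl, hcon⟩
      rw [if_neg h, if_pos this]
  refine (A.iterate_next_mono hf w H).trans
    ((A.iterate_next_tall_le hk (a + j) (by positivity) hsx w H hle).trans ?_)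
  apply ENNReal.ofReal_le_ofReal
  apply Real.exp_le_exp.2
  have : (0 : ℝ) ≤ tall (a + j + 1) H := by positivity
  linarith

open Classical in
/-- A union bound over the layers. The layers are separated by `n / 2 ^ (j + 1)` balls, which add up
to at most `n`. -/
theorem expect_run_not_layerReached_le (A : ProbeAlgorithm n k) (hk : 1 ≤ k) {m a J : ℕ}
    (hnm : n ≤ m) (ha : n * a ≤ m - n) (hJ : 2 ^ J ≤ n) (j : ℕ) (hj : j ≤ J) (t : ℕ)
    (ht : m ≤ t + n / 2 ^ j) :
    (A.run t).expect (fun H => if LayerReached k a j H then 0 else 1) ≤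
      j * ENNReal.ofReal (Real.exp (-(n / 2 ^ layerExp k J))) := by
  induction j generalizing t with
  | zero =>
    rw [Nat.cast_zero, zero_mul]
    refine (PMF.expect_mono (g := fun _ => 0) _ fun H hH => ?_).trans_eq (PMF.expect_const _ 0)
    rw [if_pos]
    refine layerReached_zero hk ?_
    rw [A.length_of_mem_support_run t H hH]
    simp only [pow_zero, Nat.div_one] at ht
    omega
  | succ j ih =>
    have h2 : n / 2 ^ (j + 1) * 2 ≤ n / 2 ^ j := by
      rw [pow_succ, ← Nat.div_div_eq_div_mul]
      exact Nat.div_mul_le_self _ _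
    have h3 : n / 2 ^ j ≤ n := Nat.div_le_self _ _
    obtain ⟨t', rfl⟩ : ∃ t', t = t' + n / 2 ^ (j + 1) := ⟨t - n / 2 ^ (j + 1), by omega⟩
    rw [A.expect_run_add]
    have hjn : 2 ^ (j + 1) ≤ n := (Nat.pow_le_pow_right two_pos hj).trans hJ
    have hone : ∀ (w : ℕ) (H : History n),
        A.next^[w] (fun H => if LayerReached k a (j + 1) H then 0 else 1) H ≤ 1 := by
      intro w
      induction w with
      | zero =>
        intro H
        simp only [Function.iterate_zero, id_eq]
        split_ifs <;> simp
      | succ w ihw =>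
        intro H
        rw [Function.iterate_succ_apply', next]
        exact (PMF.expect_mono _ fun r _ => ihw _).trans_eq (PMF.expect_const _ _)
    calc _ ≤ (A.run t').expect (fun H => (if LayerReached k a j H then 0 else 1) +
          ENNReal.ofReal (Real.exp (-(n / 2 ^ layerExp k J)))) := by
          refine PMF.expect_mono _ fun H _ => ?_
          by_cases h : LayerReached k a j H
          · rw [if_pos h, zero_add]
            refine (A.iterate_next_not_layerReached_le hk a j hjn h).trans ?_
            apply ENNReal.ofReal_le_ofReal
            gcongr
            · exact one_le_two
            · exact (layerExp_strictMono hk).monotone hj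
          · rw [if_neg h]
            exact (hone _ H).trans le_self_add
      _ ≤ _ := by
          rw [PMF.expect_add, PMF.expect_const, Nat.cast_succ, add_mul, one_mul]
          gcongr
          exact ih (by omega) t' (by omega)

open Classical in
theorem one_sub_le_maxLoadLaw (A : ProbeAlgorithm n k) (hk : 1 ≤ k) {m J : ℕ}
    (hnm : n ≤ m) (hJ : 2 ^ J ≤ n) {S : Set ℕ} (hS : ∀ L, (m - n) / n + J ≤ L → L ∈ S) :
    1 - J * Real.exp (-(n / 2 ^ layerExp k J)) ≤ (A.maxLoadLaw m).toMeasure.real S := by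
  have hbad := A.expect_run_not_layerReached_le hk (a := (m - n) / n) hnm
    (Nat.mul_div_le _ _) hJ J le_rfl m le_self_add
  have hcompl : (A.maxLoadLaw m).toMeasure Sᶜ ≤
      ENNReal.ofReal (J * Real.exp (-(n / 2 ^ layerExp k J))) := by
    rw [PMF.toMeasure_apply_eq_toOuterMeasure_apply _ (MeasurableSet.of_discrete),
      ← PMF.expect_indicator, maxLoadLaw, PMF.expect_map, ENNReal.ofReal_mul (by positivity),
      ENNReal.ofReal_natCast]
    refine le_trans (PMF.expect_mono _ fun H _ => ?_) hbad
    by_cases h : LayerReached k ((m - n) / n) J H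
    · simp [h, hS _ h.le_maxLoad]
    · rw [if_neg h]
      simp only [Function.comp_apply]
      split_ifs <;> simp
  have h1 : (A.maxLoadLaw m).toMeasure.real Sᶜ ≤ J * Real.exp (-(n / 2 ^ layerExp k J)) :=
    ENNReal.toReal_le_of_le_ofReal (by positivity) hcompl
  rw [MeasureTheory.probReal_compl_eq_one_sub MeasurableSet.of_discrete] at h1
  linarith

end ProbeAlgorithm

/-! ### The choice of the number of layers -/

/-- The choice of the number `J` of layers. It is of order `log (log n) / log k`, yet the failure
probability of a layer stays below `exp (-√n)`; for `J = 0` there is no layer that could fail, and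
the bound on the exponent would be false for small `n`. -/
theorem exists_layer_count {n k : ℕ} (hn : 2 ≤ n) (hk : 2 ≤ k) :
    ∃ J : ℕ, Real.log (Real.log n) / Real.log k - 5 ≤ J ∧
      (J = 0 ∨ (2 : ℝ) ^ layerExp k J ≤ √n) := by
  have hn0 : (0 : ℝ) < n := by positivity
  have hk2 : Real.log 2 ≤ Real.log k := Real.log_le_log two_pos (by exact_mod_cast hk)
  have hl2 : 0 < Real.log 2 := Real.log_pos one_lt_two
  have hlk : 0 < Real.log k := hl2.trans_le hk2
  have hln : 0 < Real.log n := Real.log_pos (by exact_mod_cast hn)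
  set z : ℝ := (Real.log (Real.log n) - Real.log 16) / Real.log k with hz
  refine ⟨⌊z⌋₊, ?_, ?_⟩
  · have h16 : Real.log 16 / Real.log k ≤ 4 := by
      rw [div_le_iff₀ hlk, show (16 : ℝ) = 2 ^ 4 by norm_num, Real.log_pow]
      push_cast
      linarith
    have := Nat.lt_floor_add_one z
    rw [hz, sub_div] at this
    rw [hz, sub_div]
    linarith
  · rcases Nat.eq_zero_or_pos ⌊z⌋₊ with h0 | hpos
    · exact Or.inl h0
    right
    have hJz : (⌊z⌋₊ : ℝ) ≤ z := Nat.floor_le (by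
      by_contra! hneg
      simp [Nat.floor_of_nonpos hneg.le] at hpos)
    set J := ⌊z⌋₊
    have hkJ : (k : ℝ) ^ J ≤ Real.log n / 16 := by
      rw [← Real.log_le_log_iff (by positivity) (by positivity), Real.log_pow,
        Real.log_div hln.ne' (by norm_num)]
      exact (le_div_iff₀ hlk).1 hJz
    have he : (layerExp k J : ℝ) ≤ 8 * k ^ J := by
      have := layerExp_le hk J
      exact_mod_cast (show layerExp k J ≤ 8 * k ^ J by omega)
    rw [← Real.log_le_log_iff (by positivity) (by positivity), Real.log_pow,
      Real.log_sqrt hn0.le]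
    have hl1 : Real.log 2 ≤ 1 := by linarith [Real.log_two_lt_d9]
    calc (layerExp k J : ℝ) * Real.log 2 ≤ layerExp k J * 1 := by gcongr
      _ ≤ Real.log n / 2 := by linarith

theorem mul_exp_neg_sqrt_le {n : ℝ} (hn : 0 < n) : n * Real.exp (-√n) ≤ 24 * n ^ (-1 : ℝ) := by
  have h := Real.pow_div_factorial_le_exp (√n) (Real.sqrt_nonneg n) 4
  have h4 : √n ^ 4 = n ^ 2 := by
    rw [show (4 : ℕ) = 2 * 2 by rfl, pow_mul, Real.sq_sqrt hn.le]
  rw [h4, show ((4 : ℕ).factorial : ℝ) = 24 by norm_num [Nat.factorial]] at h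
  rw [Real.rpow_neg_one, Real.exp_neg, ← div_eq_mul_inv, ← div_eq_mul_inv,
    div_le_div_iff₀ (Real.exp_pos _) hn]
  linarith

theorem theorem3 :
    ∃ C K c : ℝ, 0 < C ∧ 0 < K ∧ 0 < c ∧
      ∀ (n m k : ℕ) [NeZero n], 2 ≤ n → n ≤ m → 2 ≤ k → ∀ A : ProbeAlgorithm n k,
        1 - K * (n : ℝ) ^ (-c) ≤
          (A.maxLoadLaw m).toMeasure.real
            {L : ℕ | (m : ℝ) / (n : ℝ) + Real.log (Real.log (n : ℝ)) / Real.log (k : ℝ) - C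
              ≤ (L : ℝ)} := by
  refine ⟨7, 24, 1, by norm_num, by norm_num, one_pos, ?_⟩
  intro n m k _ hn hnm hk A
  have hn0 : (0 : ℝ) < n := by exact_mod_cast NeZero.pos n
  obtain ⟨J, hJlow, hJ⟩ := exists_layer_count hn hk
  have hexp : J ≤ layerExp k J := (Nat.le_succ J).trans (succ_le_layerExp (by omega) J)
  have hJn : 2 ^ J ≤ n := by
    rcases hJ with rfl | hJ
    · rw [pow_zero]
      omega
    · have h1 : (1 : ℝ) ≤ n := by exact_mod_cast NeZero.pos n
      have h2 : (2 : ℝ) ^ J ≤ n :=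
        (pow_le_pow_right₀ one_le_two hexp).trans
          (hJ.trans (Real.sqrt_le_iff.2 ⟨hn0.le, by nlinarith⟩))
      exact_mod_cast h2
  refine le_trans ?_ (A.one_sub_le_maxLoadLaw (by omega) hnm hJn fun L hL => ?_)
  · apply sub_le_sub_left
    refine le_trans ?_ (mul_exp_neg_sqrt_le hn0)
    rcases hJ with rfl | hJ
    · simp only [Nat.cast_zero, zero_mul]
      positivity
    · have hJle : (J : ℝ) ≤ n := by exact_mod_cast Nat.lt_two_pow_self.le.trans hJn
      have hsqrt : √(n : ℝ) ≤ n / 2 ^ layerExp k J := by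
        rw [le_div_iff₀ (by positivity)]
        calc √(n : ℝ) * 2 ^ layerExp k J ≤ √n * √n := by gcongr
          _ = n := Real.mul_self_sqrt hn0.le
      gcongr
  · rw [Set.mem_ofPred_eq]
    -- Rounding `(m - n) / n` down and setting the last `n` balls aside costs at most two.
    have hdiv : m < n * ((m - n) / n + 2) := by
      have := Nat.lt_mul_div_succ (m - n) (NeZero.pos n)
      rw [Nat.mul_add] at this ⊢
      omega
    have hdiv' : (m : ℝ) / n ≤ ((m - n) / n : ℕ) + 2 := by
      rw [div_le_iff₀ hn0, mul_comm]
      exact_mod_cast hdiv.le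
    have hL' : (((m - n) / n : ℕ) : ℝ) + J ≤ L := by exact_mod_cast hL
    linarith
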